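/- Let $d\ge 0$, let $X\subset\mathbb R^d$ be compact, and let $\mu\in\mathbb R$ (as usual $\mu\in(0,1]$, although this need not be assumed). For closed $A\subset\mathbb R^d$ write $d(x,A)=\inf_{q\in A}\|x-q\|$ and let $\Gamma_A(x)$ be the set of points of $A$ at distance $d(x,A)$ from $x$. The reach of $A$ is $\operatorname{reach}(A)=\inf\{\|q-x\| : q\in A,\ x\in\operatorname{Med}(A)\}\in[0,\infty]$, where $\operatorname{Med}(A)$ is the set of $x\in\mathbb R^d\setminus A$ for which $\Gamma_A(x)$ has at least two points. For $x\notin X$ let $\Theta_X(x)$ be the center of the smallest closed ball containing $\Gamma_X(x)$, let $\nabla_X(x)=(x-\Theta_X(x))/d(x,X)$, and let $\operatorname{Med}_\mu(X)=\{x\in\mathbb R^d\setminus X:\|\nabla_X(x)\|<\mu\}$. The $\mu$-reach of $X$ is $\tau_\mu=\inf\{\|q-x\|: q\in X,\ x\in\operatorname{Med}_\mu(X)\}\in[0,\infty]$ (with $\inf\emptyset=\infty$ in both definitions). For $t>0$ and $A\subset\mathbb R^d$ let $A^t=\bigcup_{x\in A}B(x,t)$ be the union of the open balls of radius $t$ centered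 at points of $A$, and let $A^{\complement}=\mathbb R^d\setminus A$. Suppose that $X$ has positive $\mu$-reach $\tau_\mu>0$, and let $r,s>0$ be real numbers with $r\le\tau_\mu$, $s\le r$ and $s\le\mu r$. Then the double offset $X^{r,s}:=(((X^r)^{\complement})^s)^{\complement}$ contains $X$ and deformation retracts to $X$, that is, there is a continuous map $H:X^{r,s}\times[0,1]\to X^{r,s}$ with $H(x,0)=x$ and $H(x,1)\in X$ for all $x\in X^{r,s}$, and $H(x,t)=x$ for all $x\in X$ and $t\in[0,1]$. Moreover $\operatorname{reach}(X^{r,s})\ge s$. -/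

import Mathlib

/-- The set `Γ_A(x)` of points of `A` closest to `x`. -/
def nearestPoints {d : ℕ} (A : Set (EuclideanSpace ℝ (Fin d))) (x : EuclideanSpace ℝ (Fin d)) :
    Set (EuclideanSpace ℝ (Fin d)) :=
  {q | q ∈ A ∧ dist q x = Metric.infDist x A}

/-- The medial axis of `A`: the points outside `A` with at least two nearest points in `A`. -/
def medialAxis {d : ℕ} (A : Set (EuclideanSpace ℝ (Fin d))) : Set (EuclideanSpace ℝ (Fin d)) :=
  {x | x ∉ A ∧ ∃ q₁ ∈ nearestPoints A x, ∃ q₂ ∈ nearestPoints A x, q₁ ≠ q₂}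

/-- The reach of a (closed) set `A`, the infimum of the distances between points of `A` and
points of its medial axis; it is `⊤` if the medial axis is empty. -/
noncomputable def reach {d : ℕ} (A : Set (EuclideanSpace ℝ (Fin d))) : ENNReal :=
  ⨅ q ∈ A, ⨅ x ∈ medialAxis A, edist q x

/-- `c` is the center of a closed ball of smallest radius among those containing `S`. -/
def IsSmallestBallCenter {d : ℕ} (S : Set (EuclideanSpace ℝ (Fin d)))
    (c : EuclideanSpace ℝ (Fin d)) : Prop :=
  ∃ ρ : ℝ, 0 ≤ ρ ∧ S ⊆ Metric.closedBall c ρ ∧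
    ∀ (c' : EuclideanSpace ℝ (Fin d)) (ρ' : ℝ), 0 ≤ ρ' → S ⊆ Metric.closedBall c' ρ' → ρ ≤ ρ'

/-- A nonempty bounded set has exactly one smallest enclosing ball. -/
theorem existsUnique_isSmallestBallCenter {d : ℕ} {S : Set (EuclideanSpace ℝ (Fin d))}
    (hne : S.Nonempty) (hb : Bornology.IsBounded S) : ∃! c, IsSmallestBallCenter S c := by
  obtain ⟨q₀, hq₀⟩ := hne
  obtain ⟨R, hR⟩ := hb.subset_closedBall q₀
  have hR0 : 0 ≤ R := by simpa using hR hq₀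
  let K : Set (EuclideanSpace ℝ (Fin d) × ℝ) :=
    {p | 0 ≤ p.2 ∧ p.2 ≤ R ∧ ∀ q ∈ S, dist q p.1 ≤ p.2}
  have hKc : IsClosed K := by
    have : K = {p | 0 ≤ p.2} ∩ ({p | p.2 ≤ R} ∩ ⋂ q ∈ S, {p | dist q p.1 ≤ p.2}) := by
      ext p; simp [K]
    rw [this]
    refine (isClosed_le (by fun_prop) (by fun_prop)).inter
      ((isClosed_le (by fun_prop) (by fun_prop)).inter ?_)
    exact isClosed_biInter fun q _ => isClosed_le (by fun_prop) (by fun_prop)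
  have hKs : K ⊆ Metric.closedBall q₀ R ×ˢ Set.Icc 0 R := by
    rintro ⟨c, ρ⟩ ⟨h0, h1, h2⟩
    refine ⟨?_, h0, h1⟩
    have := h2 q₀ hq₀
    rw [Metric.mem_closedBall, dist_comm]
    exact this.trans h1
  have hKcpt : IsCompact K :=
    ((isCompact_closedBall q₀ R).prod isCompact_Icc).of_isClosed_subset hKc hKs
  have hKne : K.Nonempty := ⟨(q₀, R), hR0, le_rfl, fun q hq => hR hq⟩
  obtain ⟨⟨c, ρ⟩, ⟨h0, h1, h2⟩, hmin⟩ := hKcpt.exists_isMinOn hKne continuous_snd.continuousOn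
  refine ⟨c, ⟨ρ, h0, fun q hq => h2 q hq, fun c' ρ' h0' hS' => ?_⟩, ?_⟩
  · by_cases h : ρ' ≤ R
    · exact hmin (show (c', ρ') ∈ K from ⟨h0', h, fun q hq => hS' hq⟩)
    · linarith
  · rintro c' ⟨ρ', h0', hS', hmin'⟩
    have e1 : ρ' ≤ ρ := hmin' c ρ h0 fun q hq => h2 q hq
    by_contra hne
    have hpos : 0 < ‖c' - c‖ := norm_pos_iff.2 (sub_ne_zero.2 hne)
    have key : ∀ q ∈ S, dist q (midpoint ℝ c c') ^ 2 ≤ ρ ^ 2 - ‖c' - c‖ ^ 2 / 4 := by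
      intro q hq
      have a1 : ‖q - c‖ ≤ ρ := by simpa [dist_eq_norm] using h2 q hq
      have a2 : ‖q - c'‖ ≤ ρ := by
        have := hS' hq
        rw [Metric.mem_closedBall, dist_eq_norm] at this
        exact this.trans e1
      have p := parallelogram_law_with_norm ℝ (q - c) (q - c')
      have b1 : (q - c) + (q - c') = (2 : ℝ) • (q - midpoint ℝ c c') := by
        rw [midpoint_eq_smul_add, invOf_eq_inv]; module
      have b2 : (q - c) - (q - c') = c' - c := by abel
      rw [b1, b2, norm_smul] at p
      rw [dist_eq_norm]
      norm_num at p
      nlinarith [norm_nonneg (q - c), norm_nonneg (q - c')]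
    have hnn : 0 ≤ ρ ^ 2 - ‖c' - c‖ ^ 2 / 4 := (sq_nonneg _).trans (key q₀ hq₀)
    have hlt : √(ρ ^ 2 - ‖c' - c‖ ^ 2 / 4) < ρ := by
      rw [Real.sqrt_lt hnn h0]; nlinarith
    have hle : (ρ : ℝ) ≤ √(ρ ^ 2 - ‖c' - c‖ ^ 2 / 4) := by
      refine hmin (show (midpoint ℝ c c', √(ρ ^ 2 - ‖c' - c‖ ^ 2 / 4)) ∈ K from
        ⟨Real.sqrt_nonneg _, hlt.le.trans h1, fun q hq => ?_⟩)
      exact Real.le_sqrt_of_sq_le (key q hq)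
    exact absurd hle (not_le.2 hlt)

/-- The center of `S`, that is, of the smallest ball enclosing the nonempty bounded set `S`. -/
noncomputable def smallestBallCenter {d : ℕ} (S : Set (EuclideanSpace ℝ (Fin d))) :
    EuclideanSpace ℝ (Fin d) :=
  Classical.epsilon (IsSmallestBallCenter S)

theorem isSmallestBallCenter_smallestBallCenter {d : ℕ} {S : Set (EuclideanSpace ℝ (Fin d))}
    (hne : S.Nonempty) (hb : Bornology.IsBounded S) :
    IsSmallestBallCenter S (smallestBallCenter S) :=
  Classical.epsilon_spec (existsUnique_isSmallestBallCenter hne hb).exists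

/-- The generalized gradient at `x ∉ A` of the distance function to `A`. -/
noncomputable def generalizedGradient {d : ℕ} (A : Set (EuclideanSpace ℝ (Fin d)))
    (x : EuclideanSpace ℝ (Fin d)) : EuclideanSpace ℝ (Fin d) :=
  (Metric.infDist x A)⁻¹ • (x - smallestBallCenter (nearestPoints A x))

/-- The `μ`-medial axis of `A`. -/
def muMedialAxis {d : ℕ} (μ : ℝ) (A : Set (EuclideanSpace ℝ (Fin d))) :
    Set (EuclideanSpace ℝ (Fin d)) :=
  {x | x ∉ A ∧ ‖generalizedGradient A x‖ < μ}

/-- The `μ`-reach of a (compact) set `A`, the infimum of the distances between points of `A` and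
points of its `μ`-medial axis; it is `⊤` if the `μ`-medial axis is empty. -/
noncomputable def muReach {d : ℕ} (μ : ℝ) (A : Set (EuclideanSpace ℝ (Fin d))) : ENNReal :=
  ⨅ q ∈ A, ⨅ x ∈ muMedialAxis μ A, edist q x

/-- The `r`-offset of `A`: the union of the open balls of radius `r` centered at points of `A`. -/
def offset {d : ℕ} (r : ℝ) (A : Set (EuclideanSpace ℝ (Fin d))) : Set (EuclideanSpace ℝ (Fin d)) :=
  ⋃ x ∈ A, Metric.ball x r

/-- The double offset `(((A^r)ᶜ)^s)ᶜ`. -/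
def doubleOffset {d : ℕ} (r s : ℝ) (A : Set (EuclideanSpace ℝ (Fin d))) :
    Set (EuclideanSpace ℝ (Fin d)) :=
  (offset s (offset r A)ᶜ)ᶜ

/-- `A` deformation retracts to its subset `B`: the identity of `A` is homotopic, through maps
`A → A` that fix every point of `B`, to a map with values in `B`. -/
def DeformationRetractsTo {d : ℕ} (A B : Set (EuclideanSpace ℝ (Fin d))) : Prop :=
  B ⊆ A ∧ ∃ H : C(A × unitInterval, A),
    (∀ a : A, H (a, 0) = a) ∧
    (∀ a : A, (H (a, 1) : EuclideanSpace ℝ (Fin d)) ∈ B) ∧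
    (∀ a : A, (a : EuclideanSpace ℝ (Fin d)) ∈ B → ∀ t : unitInterval, H (a, t) = a)

open Filter Topology RealInnerProductSpace

/-! The gradient bound gives every point outside `X` and below level `r` a direction making a
uniformly acute angle with all its nearest points of `X`. On the boundary of a superlevel set of the
distance to `X`, this rules out sharp corners: nearest points in the superlevel set are unique
within distance `μ` times the level (`eq_of_mem_nearestPoints_superlevel`). One can therefore climb
away from that set at almost unit rate. Letting the level tend to `r` and the rate to one puts each
point of the shell on a segment of length `s` from the complement of the offset to the double offset
(`exists_dist_add_dist_le`).

By strict convexity the nearest point in the double offset is the end of that segment, hence unique.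
So the medial axis of the double offset misses the offset, which gives the reach bound, and the
projection onto the double offset is continuous on the offset. Composing it with a flow that
contracts the offset to `X` (`exists_homotopy_to_zero_level`) gives the deformation retraction. -/

/-! ### Nearest points and descent directions. -/

theorem nearestPoints_nonempty {d : ℕ} {A : Set (EuclideanSpace ℝ (Fin d))} (hA : IsClosed A)
    (hne : A.Nonempty) (x : EuclideanSpace ℝ (Fin d)) : (nearestPoints A x).Nonempty := by
  obtain ⟨q, hq, h⟩ := hA.exists_infDist_eq_dist hne x
  exact ⟨q, hq, by rw [h, dist_comm]⟩

/-- Upper semicontinuity of the nearest point correspondence. -/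
theorem eventually_forall_nearestPoints {d : ℕ} {A : Set (EuclideanSpace ℝ (Fin d))}
    (hA : IsClosed A) {x : EuclideanSpace ℝ (Fin d)}
    {P : EuclideanSpace ℝ (Fin d) → EuclideanSpace ℝ (Fin d) → Prop}
    (h : ∀ q ∈ nearestPoints A x, ∀ᶠ z : EuclideanSpace ℝ (Fin d) × EuclideanSpace ℝ (Fin d) in
      𝓝 (x, q), P z.1 z.2) :
    ∀ᶠ y in 𝓝 x, ∀ q ∈ nearestPoints A y, P y q := by
  -- For `y` within 1 of `x`, one unit covers the change of `infDist` and one the triangle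
  -- inequality.
  have hK : IsCompact (A ∩ Metric.closedBall x (Metric.infDist x A + 2)) :=
    (isCompact_closedBall _ _).inter_left hA
  have key : ∀ᶠ y in 𝓝 x, ∀ q ∈ A ∩ Metric.closedBall x (Metric.infDist x A + 2),
      Metric.infDist y A < dist q y ∨ P y q := by
    refine hK.eventually_forall_of_forall_eventually fun q hq => ?_
    by_cases hqx : q ∈ nearestPoints A x
    · filter_upwards [h q hqx] with z hz using Or.inr hz
    · have hlt : Metric.infDist x A < dist q x := by
        refine lt_of_le_of_ne ?_ fun e => hqx ⟨hq.1, e.symm⟩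
        rw [dist_comm]; exact Metric.infDist_le_dist_of_mem hq.1
      have : ∀ᶠ z : EuclideanSpace ℝ (Fin d) × EuclideanSpace ℝ (Fin d) in 𝓝 (x, q),
          Metric.infDist z.1 A < dist z.2 z.1 :=
        (isOpen_lt ((Metric.continuous_infDist_pt A).comp continuous_fst)
          (by fun_prop)).mem_nhds hlt
      filter_upwards [this] with z hz using Or.inl hz
  filter_upwards [key, Metric.ball_mem_nhds x one_pos] with y hy hyx q hq
  have hqK : q ∈ Metric.closedBall x (Metric.infDist x A + 2) := by
    have h1 : Metric.infDist y A ≤ Metric.infDist x A + dist y x := Metric.infDist_le_infDist_add_dist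
    have h2 := hq.2
    have h3 := dist_triangle q y x
    rw [Metric.mem_ball] at hyx
    rw [Metric.mem_closedBall]
    linarith
  exact (hy q ⟨hq.1, hqK⟩).resolve_left fun h1 => h1.ne' hq.2

/-- Push the center `c` a fraction `h` toward `x`. Minimality of the radius `R` and Stewart's
identity (`conv`), after division by `h` and `h → 0`, give `R² ≤ ρ² - ‖c - x‖²`; expanding `‖q - c‖²
≤ R²` concludes. -/
theorem norm_sq_le_inner_of_isSmallestBallCenter {d : ℕ} {S : Set (EuclideanSpace ℝ (Fin d))}
    {x c : EuclideanSpace ℝ (Fin d)} {ρ : ℝ} (hS : S ⊆ Metric.sphere x ρ)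
    (hc : IsSmallestBallCenter S c) {q : EuclideanSpace ℝ (Fin d)} (hq : q ∈ S) :
    ‖c - x‖ ^ 2 ≤ ⟪c - x, q - x⟫ := by
  obtain ⟨R, hR0, hR, hmin⟩ := hc
  have conv : ∀ h : ℝ, ∀ p : EuclideanSpace ℝ (Fin d), ‖p - (c + h • (x - c))‖ ^ 2 =
      (1 - h) * ‖p - c‖ ^ 2 + h * ‖p - x‖ ^ 2 - h * (1 - h) * ‖c - x‖ ^ 2 := by
    intro h p
    have e1 : p - (c + h • (x - c)) = (p - c) + h • (c - x) := by module
    have e2 : p - x = (p - c) + (c - x) := by abel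
    rw [e1, e2, norm_add_sq_real, norm_add_sq_real, norm_smul, inner_smul_right, mul_pow,
      Real.norm_eq_abs, sq_abs]
    ring
  have hpR : ∀ p ∈ S, ‖p - c‖ ≤ R := fun p hp => by simpa [dist_eq_norm] using hR hp
  have hpρ : ∀ p ∈ S, ‖p - x‖ = ρ := fun p hp => by simpa [dist_eq_norm] using hS hp
  have step : ∀ h : ℝ, 0 < h → h < 1 → R ^ 2 ≤ ρ ^ 2 - (1 - h) * ‖c - x‖ ^ 2 := by
    intro h h0 h1
    have hb : ∀ p ∈ S, ‖p - (c + h • (x - c))‖ ^ 2 ≤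
        (1 - h) * R ^ 2 + h * ρ ^ 2 - h * (1 - h) * ‖c - x‖ ^ 2 := by
      intro p hp
      rw [conv, hpρ p hp]
      have : ‖p - c‖ ^ 2 ≤ R ^ 2 := pow_le_pow_left₀ (norm_nonneg _) (hpR p hp) 2
      nlinarith
    have hB := (sq_nonneg _).trans (hb q hq)
    have := hmin (c + h • (x - c)) _ (Real.sqrt_nonneg _) fun p hp => by
      rw [Metric.mem_closedBall, dist_eq_norm]
      exact Real.le_sqrt_of_sq_le (hb p hp)
    have h2 := (Real.le_sqrt hR0 hB).1 this
    nlinarith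
  have hlim : R ^ 2 ≤ ρ ^ 2 - ‖c - x‖ ^ 2 := by
    have ht : Tendsto (fun h : ℝ => ρ ^ 2 - (1 - h) * ‖c - x‖ ^ 2) (𝓝[>] 0)
        (𝓝 (ρ ^ 2 - (1 - 0) * ‖c - x‖ ^ 2)) :=
      (Continuous.tendsto (by fun_prop) 0).mono_left nhdsWithin_le_nhds
    have := ge_of_tendsto ht (by
      filter_upwards [Ioo_mem_nhdsGT one_pos] with h hh using step h hh.1 hh.2)
    simpa using this
  have e : q - c = (q - x) - (c - x) := by abel
  have h1 := norm_sub_sq_real (q - x) (c - x)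
  rw [← e, hpρ q hq, real_inner_comm] at h1
  have h2 : ‖q - c‖ ^ 2 ≤ R ^ 2 := pow_le_pow_left₀ (norm_nonneg _) (hpR q hq) 2
  linarith

/-- A unit vector along which the distance to `A` decreases with slope at least `μ`. -/
theorem exists_descent_direction {d : ℕ} {A : Set (EuclideanSpace ℝ (Fin d))}
    (hA : IsClosed A) (hne : A.Nonempty) {x : EuclideanSpace ℝ (Fin d)} (hx : x ∉ A)
    {μ : ℝ} (hμ : 0 < μ) (hg : μ ≤ ‖generalizedGradient A x‖) :
    ∃ v : EuclideanSpace ℝ (Fin d), ‖v‖ = 1 ∧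
      ∀ q ∈ nearestPoints A x, μ * Metric.infDist x A ≤ ⟪v, q - x⟫ := by
  have hd : 0 < Metric.infDist x A := (hA.notMem_iff_infDist_pos hne).1 hx
  set c := smallestBallCenter (nearestPoints A x) with hc
  have hsph : nearestPoints A x ⊆ Metric.sphere x (Metric.infDist x A) := fun q hq => hq.2
  have hcen : IsSmallestBallCenter (nearestPoints A x) c :=
    isSmallestBallCenter_smallestBallCenter (nearestPoints_nonempty hA hne x)
      (Metric.isBounded_sphere.subset hsph)
  have hnorm : μ * Metric.infDist x A ≤ ‖c - x‖ := by
    rw [generalizedGradient, norm_smul, norm_inv, Real.norm_eq_abs, abs_of_pos hd, ← hc,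
      norm_sub_rev, inv_mul_eq_div, le_div_iff₀ hd] at hg
    exact hg
  have hpos : 0 < ‖c - x‖ := (mul_pos hμ hd).trans_le hnorm
  refine ⟨‖c - x‖⁻¹ • (c - x), ?_, fun q hq => ?_⟩
  · rw [norm_smul, norm_inv, norm_norm, inv_mul_cancel₀ hpos.ne']
  · have := norm_sq_le_inner_of_isSmallestBallCenter hsph hcen hq
    rw [real_inner_smul_left, inv_mul_eq_div]
    refine hnorm.trans ((le_div_iff₀ hpos).2 ?_)
    rwa [← sq]

/-- By semicontinuity, the nearest points of `p + h • v` also lie behind `p` relative to `v`, so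
moving along `v` has increased the distance to them. -/
theorem eventually_infDist_le_of_inner_neg {d : ℕ} {A : Set (EuclideanSpace ℝ (Fin d))}
    (hA : IsClosed A) (hne : A.Nonempty) {p v : EuclideanSpace ℝ (Fin d)}
    (hv : ∀ q ∈ nearestPoints A p, ⟪v, q - p⟫ < 0) :
    ∀ᶠ h in 𝓝[>] (0 : ℝ), Metric.infDist p A ≤ Metric.infDist (p + h • v) A := by
  have h1 : ∀ᶠ y in 𝓝 p, ∀ q ∈ nearestPoints A y, ⟪v, q - p⟫ < 0 :=
    eventually_forall_nearestPoints hA fun q hq =>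
      (isOpen_lt (by fun_prop) continuous_const).mem_nhds (hv q hq)
  have h2 : Tendsto (fun h : ℝ => p + h • v) (𝓝[>] 0) (𝓝 p) := by
    have : Tendsto (fun h : ℝ => p + h • v) (𝓝 0) (𝓝 (p + (0 : ℝ) • v)) :=
      Continuous.tendsto (by fun_prop) 0
    rw [zero_smul, add_zero] at this
    exact this.mono_left nhdsWithin_le_nhds
  filter_upwards [h2.eventually h1, self_mem_nhdsWithin] with h hh (h0 : 0 < h)
  obtain ⟨q, hq⟩ := nearestPoints_nonempty hA hne (p + h • v)
  have hn := hh q hq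
  rw [← hq.2]
  refine (Metric.infDist_le_dist_of_mem hq.1).trans ?_
  rw [dist_comm, dist_eq_norm, dist_eq_norm]
  refine (sq_le_sq₀ (norm_nonneg _) (norm_nonneg _)).1 ?_
  have e : q - (p + h • v) = (q - p) - h • v := by abel
  rw [e, norm_sub_sq_real (q - p), inner_smul_right, real_inner_comm]
  nlinarith [sq_nonneg ‖h • v‖]

/-! ### Segments across the shell. -/

/-- Complements of offsets have reach at least `μ r`. -/
theorem eq_of_mem_nearestPoints_superlevel {d : ℕ} {X : Set (EuclideanSpace ℝ (Fin d))}
    (hX : IsClosed X) (hne : X.Nonempty) {μ r : ℝ} (hμ : 0 < μ) (hr : 0 < r)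
    (hdesc : ∀ p, Metric.infDist p X = r → ∃ v : EuclideanSpace ℝ (Fin d), ‖v‖ = 1 ∧
      ∀ q ∈ nearestPoints X p, μ * r ≤ ⟪v, q - p⟫)
    {z p₁ p₂ : EuclideanSpace ℝ (Fin d)} (hz : Metric.infDist z X < r)
    (h₁ : p₁ ∈ nearestPoints {y | r ≤ Metric.infDist y X} z)
    (h₂ : p₂ ∈ nearestPoints {y | r ≤ Metric.infDist y X} z)
    (hlt : Metric.infDist z {y | r ≤ Metric.infDist y X} < μ * r) : p₁ = p₂ := by
  set Y := {y : EuclideanSpace ℝ (Fin d) | r ≤ Metric.infDist y X} with hY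
  set t := Metric.infDist z Y
  have hzp : z ≠ p₁ := by
    rintro rfl; exact absurd h₁.1 (not_le.2 hz)
  have ht : 0 < t := by
    have := dist_pos.2 hzp.symm
    rwa [h₁.2] at this
  have htn : ‖z - p₁‖ = t := by rw [← dist_eq_norm, dist_comm]; exact h₁.2
  -- First-order optimality of `p₁`: no direction staying in `Y` approaches `z`.
  have hdir : ∀ v : EuclideanSpace ℝ (Fin d), (∀ᶠ h in 𝓝[>] (0 : ℝ), p₁ + h • v ∈ Y) →
      ⟪v, z - p₁⟫ ≤ 0 := by
    intro v hv
    by_contra! hpos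
    have : ∀ᶠ h in 𝓝[>] (0 : ℝ), h * ‖v‖ ^ 2 < 2 * ⟪v, z - p₁⟫ := by
      have : Tendsto (fun h : ℝ => h * ‖v‖ ^ 2) (𝓝[>] 0) (𝓝 (0 * ‖v‖ ^ 2)) :=
        (Continuous.tendsto (by fun_prop) 0).mono_left nhdsWithin_le_nhds
      refine this.eventually_lt_const ?_
      rw [zero_mul]; positivity
    obtain ⟨h, ⟨hh, hm⟩, h0 : 0 < h⟩ := ((this.and hv).and self_mem_nhdsWithin).exists
    have h1 : t ≤ ‖z - p₁ - h • v‖ := by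
      have := Metric.infDist_le_dist_of_mem (x := z) hm
      rwa [dist_eq_norm, ← sub_sub] at this
    have h2 := pow_le_pow_left₀ ht.le h1 2
    rw [norm_sub_sq_real, htn, inner_smul_right, norm_smul, mul_pow, Real.norm_eq_abs, sq_abs,
      real_inner_comm] at h2
    nlinarith
  have hpr : Metric.infDist p₁ X = r := by
    refine le_antisymm ?_ h₁.1
    by_contra! hgt
    have : ∀ᶠ h in 𝓝[>] (0 : ℝ), p₁ + h • (z - p₁) ∈ Y := by
      have hc : Tendsto (fun h : ℝ => Metric.infDist (p₁ + h • (z - p₁)) X) (𝓝[>] 0)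
          (𝓝 (Metric.infDist (p₁ + (0 : ℝ) • (z - p₁)) X)) :=
        (Continuous.tendsto ((Metric.continuous_infDist_pt X).comp (by fun_prop)) 0).mono_left
          nhdsWithin_le_nhds
      rw [zero_smul, add_zero] at hc
      filter_upwards [hc.eventually_const_lt hgt] with h hh using hh.le
    have := hdir _ this
    rw [real_inner_self_eq_norm_sq, htn] at this
    nlinarith
  obtain ⟨v, hv1, hv⟩ := hdesc p₁ hpr
  by_contra hne'
  set w := p₂ - p₁ with hw
  have hw0 : 0 < ‖w‖ := norm_pos_iff.2 (sub_ne_zero.2 (Ne.symm hne'))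
  have hwq : ∀ q ∈ nearestPoints X p₁, ⟪w, q - p₁⟫ ≤ ‖w‖ ^ 2 / 2 := by
    intro q hq
    have a1 : ‖q - p₁‖ = r := by rw [← dist_eq_norm, hq.2, hpr]
    have a2 : r ≤ ‖(q - p₁) - w‖ := by
      have h3 : r ≤ Metric.infDist p₂ X := h₂.1
      have := h3.trans (Metric.infDist_le_dist_of_mem hq.1)
      rw [dist_comm, dist_eq_norm] at this
      rwa [hw, sub_sub_sub_cancel_right]
    have a3 := pow_le_pow_left₀ hr.le a2 2
    rw [norm_sub_sq_real, a1, real_inner_comm] at a3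
    linarith
  have hwz : ⟪w, z - p₁⟫ = ‖w‖ ^ 2 / 2 := by
    have a1 : ‖(z - p₁) - w‖ = t := by
      rw [hw, sub_sub_sub_cancel_right, ← dist_eq_norm, dist_comm]; exact h₂.2
    have a2 := norm_sub_sq_real (z - p₁) w
    rw [a1, htn, real_inner_comm] at a2
    linarith
  have hmr : 0 < μ * r := mul_pos hμ hr
  -- choose the coefficient between `‖w‖² / (2 μ r)` and `‖w‖² / (2 t)`
  obtain ⟨a, ha1, ha2⟩ : ∃ a, ‖w‖ ^ 2 / 2 / (μ * r) < a ∧ a < ‖w‖ ^ 2 / 2 / t :=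
    exists_between (div_lt_div_of_pos_left (by positivity) ht hlt)
  rw [div_lt_iff₀ hmr] at ha1
  rw [lt_div_iff₀ ht] at ha2
  have ha0 : 0 < a := by
    by_contra! h
    nlinarith [sq_pos_of_pos hw0]
  -- The lower bound on `a` makes this direction stay in `Y`; the upper bound makes it approach `z`,
  -- against `hdir`.
  have hfin := hdir (w - a • v) (by
    have := eventually_infDist_le_of_inner_neg hX hne (p := p₁) (v := w - a • v) fun q hq => by
      rw [inner_sub_left, real_inner_smul_left]
      nlinarith [hwq q hq, hv q hq]
    filter_upwards [this] with h hh
    rwa [hpr] at hh)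
  rw [inner_sub_left, real_inner_smul_left, hwz] at hfin
  have hcs : ⟪v, z - p₁⟫ ≤ t := by
    have := real_inner_le_norm v (z - p₁)
    rwa [hv1, htn, one_mul] at this
  nlinarith

/-- The distance to `A` grows at unit rate away from a unique nearest point. -/
theorem eventually_infDist_add_smul {d : ℕ} {A : Set (EuclideanSpace ℝ (Fin d))}
    (hA : IsClosed A) {w p : EuclideanSpace ℝ (Fin d)} (hw : w ∉ A) (hp : p ∈ A)
    (huniq : ∀ q ∈ nearestPoints A w, q = p) {σ : ℝ} (hσ0 : 0 ≤ σ) (hσ1 : σ < 1) :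
    ∀ᶠ h in 𝓝[>] (0 : ℝ), Metric.infDist w A + σ * h ≤
      Metric.infDist (w + h • (‖w - p‖⁻¹ • (w - p))) A := by
  have hpos : 0 < ‖w - p‖ := norm_pos_iff.2 (sub_ne_zero.2 fun e => hw (e ▸ hp))
  set u := ‖w - p‖⁻¹ • (w - p) with hu
  have hu1 : ‖u‖ = 1 := by rw [hu, norm_smul, norm_inv, norm_norm, inv_mul_cancel₀ hpos.ne']
  have hup : ⟪u, w - p⟫ = ‖w - p‖ := by
    rw [hu, real_inner_smul_left, real_inner_self_eq_norm_sq]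
    field_simp
  have h1 : ∀ᶠ y in 𝓝 w, ∀ q ∈ nearestPoints A y, σ * ‖w - q‖ < ⟪u, w - q⟫ := by
    refine eventually_forall_nearestPoints hA fun q hq =>
      (isOpen_lt (f := fun z : EuclideanSpace ℝ (Fin d) × EuclideanSpace ℝ (Fin d) =>
        σ * ‖w - z.2‖) (by fun_prop) (by fun_prop)).mem_nhds ?_
    rw [huniq q hq]
    change σ * ‖w - p‖ < ⟪u, w - p⟫
    rw [hup]; nlinarith
  have h2 : Tendsto (fun h : ℝ => w + h • u) (𝓝[>] 0) (𝓝 w) := by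
    have : Tendsto (fun h : ℝ => w + h • u) (𝓝 0) (𝓝 (w + (0 : ℝ) • u)) :=
      Continuous.tendsto (by fun_prop) 0
    rw [zero_smul, add_zero] at this
    exact this.mono_left nhdsWithin_le_nhds
  filter_upwards [h2.eventually h1, self_mem_nhdsWithin] with h hh (h0 : 0 < h)
  obtain ⟨q, hq⟩ := nearestPoints_nonempty hA ⟨p, hp⟩ (w + h • u)
  have hn := hh q hq
  have hle : Metric.infDist w A ≤ ‖w - q‖ := by
    rw [← dist_eq_norm]; exact Metric.infDist_le_dist_of_mem hq.1
  rw [← hq.2, dist_comm, dist_eq_norm]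
  have : ‖w - q‖ + σ * h ≤ ‖w + h • u - q‖ := by
    refine (sq_le_sq₀ (by positivity) (norm_nonneg _)).1 ?_
    have e : w + h • u - q = (w - q) + h • u := by abel
    rw [e, norm_add_sq_real, inner_smul_right, real_inner_comm, norm_smul, hu1, mul_one,
      Real.norm_eq_abs, sq_abs]
    have : σ ^ 2 ≤ 1 := by nlinarith
    nlinarith [mul_le_mul_of_nonneg_right this (sq_nonneg h)]
  linarith

/-- If nearest points in `A` are unique up to distance `s`, then the level `s` of the distance to
`A` can be reached from any point outside `A` by climbing at almost unit rate. -/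
theorem exists_le_infDist_of_unique {d : ℕ} {A : Set (EuclideanSpace ℝ (Fin d))}
    (hA : IsClosed A) (hne : A.Nonempty) {s : ℝ}
    (huniq : ∀ z ∉ A, Metric.infDist z A < s →
      ∀ p₁ ∈ nearestPoints A z, ∀ p₂ ∈ nearestPoints A z, p₁ = p₂)
    {σ : ℝ} (hσ0 : 0 < σ) (hσ1 : σ < 1) {z : EuclideanSpace ℝ (Fin d)} (hz : z ∉ A)
    (hzs : Metric.infDist z A < s) :
    ∃ c, s ≤ Metric.infDist c A ∧ σ * dist z c + Metric.infDist z A ≤ s := by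
  have hz0 : 0 < Metric.infDist z A := (hA.notMem_iff_infDist_pos hne).1 hz
  have hs : 0 < s := hz0.trans hzs
  -- Maximize height minus a penalty of slope `σ`. Truncation at `s` confines the maximum to a ball,
  -- and a maximizer below level `s` could still climb at a slope above `σ`.
  have hcont : Continuous fun w => min (Metric.infDist w A) s - σ * dist z w :=
    ((Metric.continuous_infDist_pt A).min continuous_const).sub (by fun_prop)
  obtain ⟨c, -, hc⟩ := (isCompact_closedBall z (s / σ)).exists_isMaxOn
    ⟨z, Metric.mem_closedBall_self (by positivity)⟩ hcont.continuousOn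
  have hval : Metric.infDist z A ≤ min (Metric.infDist c A) s - σ * dist z c := by
    have : min (Metric.infDist z A) s - σ * dist z z ≤ min (Metric.infDist c A) s - σ * dist z c :=
      hc (Metric.mem_closedBall_self (by positivity))
    rwa [dist_self, mul_zero, sub_zero, min_eq_left hzs.le] at this
  have hmax : ∀ w, min (Metric.infDist w A) s - σ * dist z w ≤
      min (Metric.infDist c A) s - σ * dist z c := by
    intro w
    by_cases hw : w ∈ Metric.closedBall z (s / σ)
    · exact hc hw
    · rw [Metric.mem_closedBall, not_le, div_lt_iff₀ hσ0, dist_comm] at hw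
      have := min_le_right (Metric.infDist w A) s
      linarith
  have hsc : s ≤ Metric.infDist c A := by
    by_contra! hlt
    rw [min_eq_left hlt.le] at hval hmax
    have hc0 : 0 < Metric.infDist c A := by
      have : 0 ≤ σ * dist z c := by positivity
      linarith
    have hcA : c ∉ A := (hA.notMem_iff_infDist_pos hne).2 hc0
    obtain ⟨p, hp⟩ := nearestPoints_nonempty hA hne c
    have h1 := eventually_infDist_add_smul hA hcA hp.1
      (fun q hq => huniq c hcA hlt q hq p hp) (σ := (1 + σ) / 2) (by positivity) (by linarith)
    have h2 : ∀ᶠ h in 𝓝[>] (0 : ℝ), Metric.infDist c A + (1 + σ) / 2 * h < s := by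
      have : Tendsto (fun h : ℝ => Metric.infDist c A + (1 + σ) / 2 * h) (𝓝[>] 0)
          (𝓝 (Metric.infDist c A + (1 + σ) / 2 * 0)) :=
        (Continuous.tendsto (by fun_prop) 0).mono_left nhdsWithin_le_nhds
      refine this.eventually_lt_const ?_
      linarith
    obtain ⟨h, ⟨hh1, hh2⟩, h0 : 0 < h⟩ := ((h1.and h2).and self_mem_nhdsWithin).exists
    have hpos : 0 < ‖c - p‖ := norm_pos_iff.2 (sub_ne_zero.2 fun e => hcA (e ▸ hp.1))
    set w := c + h • (‖c - p‖⁻¹ • (c - p)) with hw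
    have hd : dist z w ≤ dist z c + h := by
      refine (dist_triangle z c w).trans (add_le_add_right ?_ _)
      rw [dist_comm, dist_eq_norm, hw, add_sub_cancel_left, norm_smul, norm_smul, norm_inv,
        norm_norm, inv_mul_cancel₀ hpos.ne', mul_one, Real.norm_eq_abs, abs_of_pos h0]
    have h3 := hmax w
    have h4 : Metric.infDist c A + (1 + σ) / 2 * h ≤ min (Metric.infDist w A) s :=
      le_min hh1 hh2.le
    nlinarith
  rw [min_eq_right hsc] at hval
  exact ⟨c, hsc, by linarith⟩

/-- A point of the shell between the double offset and the complement of the offset lies on a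
segment of length at most `s` joining these two sets. -/
theorem exists_dist_add_dist_le {d : ℕ} {X : Set (EuclideanSpace ℝ (Fin d))}
    (hX : IsClosed X) (hne : X.Nonempty) {μ r s : ℝ} (hμ : 0 < μ) (hr : 0 < r) (hs : 0 < s)
    (hg : ∀ x ∉ X, Metric.infDist x X < r → μ ≤ ‖generalizedGradient X x‖) (hsμ : s ≤ μ * r)
    {z y₀ : EuclideanSpace ℝ (Fin d)} (hz : Metric.infDist z X < r)
    (hy₀ : r ≤ Metric.infDist y₀ X) (hzy₀ : dist z y₀ < s) :
    ∃ y c, r ≤ Metric.infDist y X ∧ (∀ y', r ≤ Metric.infDist y' X → s ≤ dist c y') ∧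
      dist z c + dist z y ≤ s := by
  -- The parameter `σ` scales both the level and the climbing rate, since the gradient bound is
  -- available only strictly below level `r`. The bound `2⁻¹` keeps `σ` away from zero, so `K` is
  -- compact; its projection is closed, contains all `σ < 1` near 1, and hence contains 1.
  let K : Set (ℝ × EuclideanSpace ℝ (Fin d) × EuclideanSpace ℝ (Fin d)) :=
    {k | 2⁻¹ ≤ k.1 ∧ k.1 ≤ 1 ∧ k.1 * r ≤ Metric.infDist k.2.1 X ∧
      (∀ y', r ≤ Metric.infDist y' X → k.1 * s ≤ dist k.2.2 y') ∧
      k.1 * dist z k.2.2 + dist z k.2.1 ≤ k.1 * s}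
  have hKc : IsClosed K := by
    have hK : K = {k | 2⁻¹ ≤ k.1} ∩ ({k | k.1 ≤ 1} ∩ ({k | k.1 * r ≤ Metric.infDist k.2.1 X} ∩
        ((⋂ y', ⋂ (_ : r ≤ Metric.infDist y' X), {k | k.1 * s ≤ dist k.2.2 y'}) ∩
          {k | k.1 * dist z k.2.2 + dist z k.2.1 ≤ k.1 * s}))) := by
      ext k; simp [K]
    rw [hK]
    refine (isClosed_le (by fun_prop) (by fun_prop)).inter
      ((isClosed_le (by fun_prop) (by fun_prop)).inter
      ((isClosed_le (by fun_prop)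
        ((Metric.continuous_infDist_pt X).comp (by fun_prop))).inter
      (IsClosed.inter ?_ (isClosed_le (by fun_prop) (by fun_prop)))))
    exact isClosed_iInter fun y' => isClosed_iInter fun _ => isClosed_le (by fun_prop) (by fun_prop)
  have hKs : K ⊆ Set.Icc 2⁻¹ 1 ×ˢ Metric.closedBall z s ×ˢ Metric.closedBall z s := by
    rintro ⟨σ, y, c⟩ ⟨h1, h2, -, -, h3⟩
    dsimp only at h1 h2 h3
    refine ⟨⟨h1, h2⟩, ?_, ?_⟩
    · rw [Metric.mem_closedBall, dist_comm]
      nlinarith [dist_nonneg (x := z) (y := c)]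
    · rw [Metric.mem_closedBall, dist_comm]
      nlinarith [dist_nonneg (x := z) (y := y)]
  have hKcpt : IsCompact K := (isCompact_Icc.prod
    ((isCompact_closedBall z s).prod (isCompact_closedBall z s))).of_isClosed_subset hKc hKs
  have himg : IsClosed (Prod.fst '' K) := (hKcpt.image continuous_fst).isClosed
  have hev : ∀ᶠ σ in 𝓝[<] (1 : ℝ), σ ∈ Prod.fst '' K := by
    have hlim : ∀ a : ℝ, Tendsto (fun σ : ℝ => σ * a) (𝓝[<] 1) (𝓝 a) := fun a => by
      have : Tendsto (fun σ : ℝ => σ * a) (𝓝 1) (𝓝 (1 * a)) := Continuous.tendsto (by fun_prop) 1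
      rw [one_mul] at this
      exact this.mono_left nhdsWithin_le_nhds
    filter_upwards [(hlim r).eventually_const_lt hz, (hlim s).eventually_const_lt hzy₀,
      Ioo_mem_nhdsLT (show (2⁻¹ : ℝ) < 1 by norm_num)] with σ h1 h2 h3
    have hσ0 : 0 < σ := lt_trans (by norm_num) h3.1
    set Y := {y | σ * r ≤ Metric.infDist y X} with hY
    have hYc : IsClosed Y := isClosed_le continuous_const (Metric.continuous_infDist_pt X)
    have hsub : ∀ y', r ≤ Metric.infDist y' X → y' ∈ Y := fun y' hy' => by
      have : σ * r ≤ r := by nlinarith [h3.2]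
      exact this.trans hy'
    have hYne : Y.Nonempty := ⟨y₀, hsub y₀ hy₀⟩
    have hdesc : ∀ p, Metric.infDist p X = σ * r → ∃ v : EuclideanSpace ℝ (Fin d), ‖v‖ = 1 ∧
        ∀ q ∈ nearestPoints X p, μ * (σ * r) ≤ ⟪v, q - p⟫ := by
      intro p hp
      have hpX : p ∉ X := (hX.notMem_iff_infDist_pos hne).2 (by rw [hp]; positivity)
      rw [← hp]
      exact exists_descent_direction hX hne hpX hμ (hg p hpX (by rw [hp]; nlinarith [h3.2]))
    have huniq : ∀ w ∉ Y, Metric.infDist w Y < σ * s →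
        ∀ p₁ ∈ nearestPoints Y w, ∀ p₂ ∈ nearestPoints Y w, p₁ = p₂ := by
      intro w hw hws p₁ hp₁ p₂ hp₂
      exact eq_of_mem_nearestPoints_superlevel hX hne hμ (by positivity) hdesc (not_le.1 hw)
        hp₁ hp₂ (hws.trans_le (by nlinarith))
    have hzY : z ∉ Y := not_le.2 h1
    have hzs : Metric.infDist z Y < σ * s :=
      (Metric.infDist_le_dist_of_mem (hsub y₀ hy₀)).trans_lt h2
    obtain ⟨c, hc1, hc2⟩ := exists_le_infDist_of_unique hYc hYne huniq hσ0 h3.2 hzY hzs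
    obtain ⟨y, hy⟩ := nearestPoints_nonempty hYc hYne z
    refine ⟨(σ, y, c), ⟨h3.1.le, h3.2.le, hy.1, fun y' hy' =>
      hc1.trans (Metric.infDist_le_dist_of_mem (hsub y' hy')), ?_⟩, rfl⟩
    change σ * dist z c + dist z y ≤ σ * s
    rwa [dist_comm z y, hy.2]
  obtain ⟨⟨σ, y, c⟩, ⟨-, -, h1, h2, h3⟩, rfl : σ = 1⟩ :=
    himg.mem_of_tendsto (tendsto_id.mono_left nhdsWithin_le_nhds) hev
  simp only [one_mul] at h1 h2 h3
  exact ⟨y, c, h1, h2, h3⟩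

/-! ### Projection onto the double offset and its reach. -/

theorem mem_offset_iff {d : ℕ} {X : Set (EuclideanSpace ℝ (Fin d))} (hne : X.Nonempty) {r : ℝ}
    {x : EuclideanSpace ℝ (Fin d)} : x ∈ offset r X ↔ Metric.infDist x X < r := by
  simp [offset, Metric.infDist_lt_iff hne]

theorem mem_doubleOffset_iff {d : ℕ} {X : Set (EuclideanSpace ℝ (Fin d))} (hne : X.Nonempty)
    {r s : ℝ} {x : EuclideanSpace ℝ (Fin d)} :
    x ∈ doubleOffset r s X ↔ ∀ y, r ≤ Metric.infDist y X → s ≤ dist x y := by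
  have : x ∈ doubleOffset r s X ↔ ∀ y ∈ (offset r X)ᶜ, s ≤ dist x y := by
    simp [doubleOffset, offset]
  simp only [this, Set.mem_compl_iff, mem_offset_iff hne, not_lt]

theorem isClosed_doubleOffset {d : ℕ} (X : Set (EuclideanSpace ℝ (Fin d))) (r s : ℝ) :
    IsClosed (doubleOffset r s X) :=
  (isOpen_biUnion fun _ _ => Metric.isOpen_ball).isClosed_compl

/-- Equality in the triangle inequality puts both points on the ray from `y` through `z`, where the
distance past `z` determines them. -/
theorem eq_of_dist_add_dist_eq {E : Type*} [NormedAddCommGroup E] [NormedSpace ℝ E]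
    [StrictConvexSpace ℝ E] {y z w₁ w₂ : E} (hyz : y ≠ z)
    (h₁ : dist w₁ y = dist w₁ z + dist z y) (h₂ : dist w₂ y = dist w₂ z + dist z y)
    (h : dist w₁ z = dist w₂ z) : w₁ = w₂ := by
  have key : ∀ w : E, dist w y = dist w z + dist z y →
      ‖w - z‖ • (z - y) = ‖z - y‖ • (w - z) := fun w hw => by
    rw [← sameRay_iff_norm_smul_eq, sameRay_iff_norm_add]
    simpa [dist_eq_norm] using hw
  have e₁ := key w₁ h₁
  have e₂ := key w₂ h₂
  rw [← dist_eq_norm w₁ z, h, dist_eq_norm w₂ z, e₂] at e₁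
  have hpos : ‖z - y‖ ≠ 0 := norm_ne_zero_iff.2 (sub_ne_zero.2 hyz.symm)
  exact (sub_left_injective (smul_right_injective E hpos e₁)).symm

/-- Every point of the offset has at most one nearest point in the double offset. -/
theorem eq_of_mem_nearestPoints_doubleOffset {d : ℕ} {X : Set (EuclideanSpace ℝ (Fin d))}
    (hX : IsClosed X) (hne : X.Nonempty) {μ r s : ℝ} (hμ : 0 < μ) (hr : 0 < r) (hs : 0 < s)
    (hg : ∀ x ∉ X, Metric.infDist x X < r → μ ≤ ‖generalizedGradient X x‖) (hsμ : s ≤ μ * r)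
    {z w₁ w₂ : EuclideanSpace ℝ (Fin d)} (hz : Metric.infDist z X < r)
    (h₁ : w₁ ∈ nearestPoints (doubleOffset r s X) z)
    (h₂ : w₂ ∈ nearestPoints (doubleOffset r s X) z) : w₁ = w₂ := by
  by_cases hzD : z ∈ doubleOffset r s X
  · have h0 := Metric.infDist_zero_of_mem hzD
    rw [dist_eq_zero.1 (h₁.2.trans h0), dist_eq_zero.1 (h₂.2.trans h0)]
  have hzD' := hzD
  rw [mem_doubleOffset_iff hne] at hzD'
  push Not at hzD'
  obtain ⟨y₀, hy₀, hzy₀⟩ := hzD'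
  obtain ⟨y, c, hy, hc, hyc⟩ := exists_dist_add_dist_le hX hne hμ hr hs hg hsμ hz hy₀ hzy₀
  -- A nearest point is no farther than `c`, yet at least `s` from `y`, so `z` lies on the segment
  -- from `y` to `w`.
  have key : ∀ w ∈ nearestPoints (doubleOffset r s X) z, dist w y = dist w z + dist z y := by
    intro w hw
    refine le_antisymm (dist_triangle _ _ _) ?_
    have e1 : dist w z ≤ dist z c := by
      rw [hw.2]; exact Metric.infDist_le_dist_of_mem ((mem_doubleOffset_iff hne).2 hc)
    have e2 := (mem_doubleOffset_iff hne).1 hw.1 y hy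
    linarith
  have hyz : y ≠ z := by rintro rfl; exact absurd hz (not_lt.2 hy)
  exact eq_of_dist_add_dist_eq hyz (key _ h₁) (key _ h₂) (h₁.2.trans h₂.2.symm)

/-- Uniqueness of nearest points forces the medial axis outside the offset, a region from which the
double offset keeps distance `s`. -/
theorem ofReal_le_reach_doubleOffset {d : ℕ} {X : Set (EuclideanSpace ℝ (Fin d))}
    (hX : IsClosed X) (hne : X.Nonempty) {μ r s : ℝ} (hμ : 0 < μ) (hr : 0 < r) (hs : 0 < s)
    (hg : ∀ x ∉ X, Metric.infDist x X < r → μ ≤ ‖generalizedGradient X x‖) (hsμ : s ≤ μ * r) :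
    ENNReal.ofReal s ≤ reach (doubleOffset r s X) := by
  refine le_iInf₂ fun q hq => le_iInf₂ fun x hx => ?_
  obtain ⟨-, w₁, hw₁, w₂, hw₂, hw⟩ := hx
  rw [edist_dist]
  refine ENNReal.ofReal_le_ofReal ((mem_doubleOffset_iff hne).1 hq x ?_)
  by_contra! h
  exact hw (eq_of_mem_nearestPoints_doubleOffset hX hne hμ hr hs hg hsμ h hw₁ hw₂)

/-! ### The flow down to `X`. -/

theorem infDist_add_smul_le {d : ℕ} {A : Set (EuclideanSpace ℝ (Fin d))}
    {x w q : EuclideanSpace ℝ (Fin d)} (hq : q ∈ nearestPoints A x) (hw : ‖w‖ ≤ 1) {c τ : ℝ}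
    (hc0 : 0 ≤ c) (hc1 : c ≤ 1) (hτ0 : 0 ≤ τ) (hτ1 : τ ≤ 1)
    (h : c * Metric.infDist x A ≤ ⟪w, q - x⟫) :
    Metric.infDist (x + τ • (c * Metric.infDist x A) • w) A ≤
      (1 - τ * (c ^ 2 / 2)) * Metric.infDist x A := by
  have hqx : ‖q - x‖ = Metric.infDist x A := by rw [← dist_eq_norm]; exact hq.2
  set D := Metric.infDist x A with hD
  have hD0 : 0 ≤ D := Metric.infDist_nonneg
  refine (Metric.infDist_le_dist_of_mem hq.1).trans ?_
  have hτc : τ * (c ^ 2 / 2) ≤ 1 := by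
    have : c ^ 2 ≤ 1 := by nlinarith
    nlinarith [sq_nonneg c]
  refine (sq_le_sq₀ dist_nonneg (mul_nonneg (by linarith) hD0)).1 ?_
  have e : q - (x + τ • (c * D) • w) = (q - x) - (τ * (c * D)) • w := by
    rw [smul_smul]; abel
  rw [dist_comm, dist_eq_norm, e, norm_sub_sq_real, hqx, inner_smul_right, real_inner_comm,
    norm_smul, mul_pow, Real.norm_eq_abs, sq_abs]
  have h1 : τ * (c * D) * (c * D) ≤ τ * (c * D) * ⟪w, q - x⟫ :=
    mul_le_mul_of_nonneg_left h (by positivity)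
  have h2 : (τ * (c * D)) ^ 2 * ‖w‖ ^ 2 ≤ (τ * (c * D)) ^ 2 :=
    mul_le_of_le_one_right (sq_nonneg _) (pow_le_one₀ (norm_nonneg _) hw)
  have h3 : (τ * (c * D)) ^ 2 ≤ τ * (c * D) * (c * D) := by
    have : 0 ≤ τ * (1 - τ) * (c * D) ^ 2 :=
      mul_nonneg (mul_nonneg hτ0 (by linarith)) (sq_nonneg _)
    nlinarith
  nlinarith [sq_nonneg (τ * (c ^ 2 / 2) * D)]

/-- A continuous vector field along which the distance to `X` decreases geometrically. -/
theorem exists_continuousOn_descent {d : ℕ} {X : Set (EuclideanSpace ℝ (Fin d))}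
    (hX : IsClosed X) (hne : X.Nonempty) {μ r : ℝ} (hμ : 0 < μ)
    (hg : ∀ x ∉ X, Metric.infDist x X < r → μ ≤ ‖generalizedGradient X x‖) :
    ∃ (V : EuclideanSpace ℝ (Fin d) → EuclideanSpace ℝ (Fin d)) (κ : ℝ), 0 < κ ∧ κ ≤ 1 ∧
      ContinuousOn V {x | Metric.infDist x X < r} ∧
      (∀ x, ‖V x‖ ≤ Metric.infDist x X) ∧
      ∀ x, Metric.infDist x X < r → ∀ τ : ℝ, 0 ≤ τ → τ ≤ 1 →
        Metric.infDist (x + τ • V x) X ≤ (1 - τ * κ) * Metric.infDist x X := by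
  classical
  -- Strictness of `c < μ` makes the descent condition open, so one direction serves a whole
  -- neighborhood; `c ≤ 1` bounds the step length by the distance to `X`.
  obtain ⟨c, hc0, hc1, hcμ⟩ : ∃ c : ℝ, 0 < c ∧ c ≤ 1 ∧ c < μ :=
    ⟨min 1 (μ / 2), by positivity, min_le_left _ _, (min_le_right _ _).trans_lt (by linarith)⟩
  let S : Set (EuclideanSpace ℝ (Fin d)) := {x | Metric.infDist x X < r} \ X
  have hU : IsOpen {x : EuclideanSpace ℝ (Fin d) | Metric.infDist x X < r} :=
    isOpen_lt (Metric.continuous_infDist_pt X) continuous_const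
  have hS : IsOpen S := hU.sdiff hX
  let T : S → Set (EuclideanSpace ℝ (Fin d)) := fun y =>
    {v | ‖v‖ ≤ 1 ∧ ∀ q ∈ nearestPoints X y.1, c * Metric.infDist y.1 X ≤ ⟪v, q - y.1⟫}
  -- The admissible directions form convex sets, so local constant choices glue by a partition of
  -- unity.
  obtain ⟨g, hgT⟩ : ∃ g : C(S, EuclideanSpace ℝ (Fin d)), ∀ x, g x ∈ T x := by
    refine exists_continuous_forall_mem_convex_of_local_const (fun y => ?_) fun x => ?_
    · rintro v ⟨hv1, hv2⟩ w ⟨hw1, hw2⟩ a b ha hb hab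
      refine ⟨?_, fun q hq => ?_⟩
      · refine (norm_add_le _ _).trans ?_
        rw [norm_smul, norm_smul, Real.norm_of_nonneg ha, Real.norm_of_nonneg hb]
        nlinarith
      · rw [inner_add_left, real_inner_smul_left, real_inner_smul_left]
        have h1 := mul_le_mul_of_nonneg_left (hv2 q hq) ha
        have h2 := mul_le_mul_of_nonneg_left (hw2 q hq) hb
        calc c * Metric.infDist y.1 X = (a + b) * (c * Metric.infDist y.1 X) := by
              rw [hab, one_mul]
          _ ≤ _ := by linarith
    · obtain ⟨v, hv1, hv⟩ := exists_descent_direction hX hne x.2.2 hμ (hg x.1 x.2.2 x.2.1)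
      have hpos : 0 < Metric.infDist x.1 X := (hX.notMem_iff_infDist_pos hne).1 x.2.2
      have hev := eventually_forall_nearestPoints hX (x := x.1)
        (P := fun y q => c * Metric.infDist y X < ⟪v, q - y⟫) fun q hq =>
          (isOpen_lt (f := fun z : EuclideanSpace ℝ (Fin d) × EuclideanSpace ℝ (Fin d) =>
            c * Metric.infDist z.1 X)
            (continuous_const.mul ((Metric.continuous_infDist_pt X).comp continuous_fst))
            (by fun_prop)).mem_nhds
            (show c * Metric.infDist x.1 X < ⟪v, q - x.1⟫ by nlinarith [hv q hq])
      refine ⟨v, ?_⟩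
      filter_upwards [continuous_subtype_val.continuousAt.eventually hev] with y hy
      exact ⟨hv1.le, fun q hq => (hy q hq).le⟩
  let V : EuclideanSpace ℝ (Fin d) → EuclideanSpace ℝ (Fin d) := fun x =>
    if h : x ∈ S then (c * Metric.infDist x X) • g ⟨x, h⟩ else 0
  have hV1 : ∀ x (h : x ∈ S), V x = (c * Metric.infDist x X) • g ⟨x, h⟩ := fun x h => dif_pos h
  have hVn : ∀ x, ‖V x‖ ≤ Metric.infDist x X := by
    intro x
    have h0 : 0 ≤ Metric.infDist x X := Metric.infDist_nonneg
    by_cases h : x ∈ S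
    · rw [hV1 x h, norm_smul, Real.norm_of_nonneg (by positivity)]
      have := (hgT ⟨x, h⟩).1
      calc c * Metric.infDist x X * ‖g ⟨x, h⟩‖ ≤ c * Metric.infDist x X * 1 := by gcongr
        _ ≤ Metric.infDist x X := by nlinarith
    · simpa [V, h] using h0
  refine ⟨V, c ^ 2 / 2, by positivity, by nlinarith, ?_, hVn, fun x hx τ hτ0 hτ1 => ?_⟩
  · intro x hx
    refine ContinuousAt.continuousWithinAt ?_
    by_cases hxX : x ∈ X
    · have hVx : V x = 0 := dif_neg fun h => h.2 hxX
      rw [ContinuousAt, hVx]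
      refine squeeze_zero_norm hVn ?_
      have := (Metric.continuous_infDist_pt X).tendsto x
      rwa [Metric.infDist_zero_of_mem hxX] at this
    · have hc : ContinuousOn V S := by
        rw [continuousOn_iff_continuous_domRestrict]
        have : S.domRestrict V = fun y : S => (c * Metric.infDist y.1 X) • g y := by
          ext1 y; exact hV1 y.1 y.2
        rw [this]
        exact (continuous_const.mul ((Metric.continuous_infDist_pt X).comp
          continuous_subtype_val)).smul g.continuous
      exact hc.continuousAt (hS.mem_nhds ⟨hx, hxX⟩)
  · by_cases hxX : x ∈ X
    · have hVx : V x = 0 := dif_neg fun h => h.2 hxX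
      rw [hVx, smul_zero, add_zero, Metric.infDist_zero_of_mem hxX, mul_zero]
    · have hxS : x ∈ S := ⟨hx, hxX⟩
      obtain ⟨q, hq⟩ := nearestPoints_nonempty hX hne x
      rw [hV1 x hxS]
      exact infDist_add_smul_le hq (hgT ⟨x, hxS⟩).1 hc0.le hc1 hτ0 hτ1 ((hgT ⟨x, hxS⟩).2 q hq)

/-- The ramp that increases from `0` to `1` on the interval `[1 - 2⁻ⁿ, 1 - 2⁻ⁿ⁻¹]`. -/
noncomputable def dyadicRamp (n : ℕ) (t : ℝ) : ℝ := max 0 (min 1 (2 ^ (n + 1) * (t - 1) + 2))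

theorem continuous_dyadicRamp (n : ℕ) : Continuous (dyadicRamp n) := by
  unfold dyadicRamp; fun_prop

theorem dyadicRamp_nonneg (n : ℕ) (t : ℝ) : 0 ≤ dyadicRamp n t := le_max_left _ _

theorem dyadicRamp_le_one (n : ℕ) (t : ℝ) : dyadicRamp n t ≤ 1 :=
  max_le zero_le_one (min_le_left _ _)

theorem dyadicRamp_zero (n : ℕ) : dyadicRamp n 0 = 0 := by
  have : (1 : ℝ) ≤ 2 ^ n := one_le_pow₀ one_le_two
  refine max_eq_left ((min_le_right _ _).trans ?_)
  rw [pow_succ]; linarith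

theorem dyadicRamp_one (n : ℕ) : dyadicRamp n 1 = 1 := by
  norm_num [dyadicRamp]

/-- Steps run one at a time: each starts only after its predecessor is complete. -/
theorem dyadicRamp_eq_one_of_succ {n : ℕ} {t : ℝ} (h : dyadicRamp (n + 1) t ≠ 0) :
    dyadicRamp n t = 1 := by
  have h1 : 0 < (2 : ℝ) ^ (n + 1 + 1) * (t - 1) + 2 := by
    by_contra! hle
    exact h (max_eq_left ((min_le_right _ _).trans hle))
  rw [pow_succ] at h1
  rw [dyadicRamp, min_eq_left (by linarith), max_eq_right zero_le_one]

/-- The sublevel set of the distance to `X` flows down to `X`. -/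
theorem exists_homotopy_to_zero_level {d : ℕ} {X : Set (EuclideanSpace ℝ (Fin d))}
    (hX : IsClosed X) (hne : X.Nonempty) {μ r : ℝ} (hμ : 0 < μ)
    (hg : ∀ x ∉ X, Metric.infDist x X < r → μ ≤ ‖generalizedGradient X x‖) :
    ∃ H : EuclideanSpace ℝ (Fin d) × ℝ → EuclideanSpace ℝ (Fin d),
      ContinuousOn H ({x | Metric.infDist x X < r} ×ˢ Set.univ) ∧
      (∀ x, H (x, 0) = x) ∧
      (∀ x, Metric.infDist x X < r → H (x, 1) ∈ X) ∧
      (∀ x ∈ X, ∀ t, H (x, t) = x) ∧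
      ∀ x t, Metric.infDist x X < r → Metric.infDist (H (x, t)) X ≤ Metric.infDist x X := by
  obtain ⟨V, κ, hκ0, hκ1, hVc, hVn, hV⟩ := exists_continuousOn_descent hX hne hμ hg
  let U : Set (EuclideanSpace ℝ (Fin d)) := {x | Metric.infDist x X < r}
  let F : EuclideanSpace ℝ (Fin d) → EuclideanSpace ℝ (Fin d) := fun x => x + V x
  have hF : ∀ x ∈ U, Metric.infDist (F x) X ≤ (1 - κ) * Metric.infDist x X := fun x hx => by
    simpa using hV x hx 1 zero_le_one le_rfl
  have hFU : Set.MapsTo F U U := fun x hx => by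
    have h0 : 0 ≤ Metric.infDist x X := Metric.infDist_nonneg
    exact ((hF x hx).trans (by nlinarith)).trans_lt hx
  have hiter : ∀ n, ∀ x ∈ U, Metric.infDist (F^[n] x) X ≤ (1 - κ) ^ n * Metric.infDist x X := by
    intro n x hx
    induction n with
    | zero => simp
    | succ n ih =>
      rw [Function.iterate_succ_apply', pow_succ', mul_assoc]
      exact (hF _ (hFU.iterate n hx)).trans (mul_le_mul_of_nonneg_left ih (by linarith))
  have hiter' : ∀ n, ∀ x ∈ U, Metric.infDist (F^[n] x) X ≤ Metric.infDist x X := fun n x hx =>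
    (hiter n x hx).trans (mul_le_of_le_one_left Metric.infDist_nonneg
      (pow_le_one₀ (by linarith) (by linarith)))
  have hFc : ContinuousOn F U := continuousOn_id.add hVc
  have hFnc : ∀ n, ContinuousOn (F^[n]) U := fun n => hFc.iterate hFU n
  -- The homotopy follows the polygon through the iterates of `F`, with infinitely many steps by
  -- time 1; geometric decay of the steps makes the series uniformly convergent.
  let f : ℕ → EuclideanSpace ℝ (Fin d) × ℝ → EuclideanSpace ℝ (Fin d) := fun n p =>
    dyadicRamp n p.2 • V (F^[n] p.1)
  have hfb : ∀ n, ∀ p ∈ U ×ˢ (Set.univ : Set ℝ), ‖f n p‖ ≤ (1 - κ) ^ n * r := by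
    rintro n ⟨x, t⟩ ⟨hx, -⟩
    have hx' : Metric.infDist x X < r := hx
    rw [norm_smul, Real.norm_of_nonneg (dyadicRamp_nonneg n t)]
    calc dyadicRamp n t * ‖V (F^[n] x)‖ ≤ 1 * ‖V (F^[n] x)‖ := by
          gcongr; exact dyadicRamp_le_one n t
      _ ≤ (1 - κ) ^ n * Metric.infDist x X := by
          rw [one_mul]; exact (hVn _).trans (hiter n x hx)
      _ ≤ (1 - κ) ^ n * r := mul_le_mul_of_nonneg_left hx'.le (pow_nonneg (by linarith) n)
  have hsum : Summable fun n : ℕ => (1 - κ) ^ n * r :=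
    (summable_geometric_of_lt_one (by linarith) (by linarith)).mul_right r
  have hfs : ∀ x ∈ U, ∀ t, Tendsto (fun N => x + ∑ n ∈ Finset.range N, f n (x, t)) atTop
      (𝓝 (x + ∑' n, f n (x, t))) := fun x hx t =>
    tendsto_const_nhds.add (Summable.of_norm_bounded hsum
      fun n => hfb n (x, t) ⟨hx, trivial⟩).hasSum.tendsto_sum_nat
  have hpart : ∀ x ∈ U, ∀ t, ∀ N,
      Metric.infDist (x + ∑ n ∈ Finset.range N, f n (x, t)) X ≤ Metric.infDist x X ∧
      (dyadicRamp N t ≠ 0 → x + ∑ n ∈ Finset.range N, f n (x, t) = F^[N] x) := by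
    intro x hx t N
    induction N with
    | zero => simp
    | succ N ih =>
      rw [Finset.sum_range_succ, ← add_assoc]
      by_cases h0 : dyadicRamp N t = 0
      · refine ⟨?_, fun h => absurd (dyadicRamp_eq_one_of_succ h) (by simp [h0])⟩
        simpa [f, h0] using ih.1
      · rw [ih.2 h0]
        refine ⟨?_, fun h => ?_⟩
        · refine (hV _ (hFU.iterate N hx) _ (dyadicRamp_nonneg N t)
            (dyadicRamp_le_one N t)).trans ((mul_le_of_le_one_left Metric.infDist_nonneg ?_).trans
              (hiter' N x hx))
          have := mul_nonneg (dyadicRamp_nonneg N t) hκ0.le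
          linarith
        · simp [f, dyadicRamp_eq_one_of_succ h, Function.iterate_succ_apply', F]
  refine ⟨fun p => p.1 + ∑' n, f n p, ?_, fun x => ?_, fun x hx => ?_, fun x hx t => ?_,
    fun x t hx => ?_⟩
  · refine continuousOn_fst.add (continuousOn_tsum (fun n => ?_) hsum hfb)
    refine ((continuous_dyadicRamp n).comp continuous_snd).continuousOn.smul ?_
    exact hVc.comp ((hFnc n).comp continuousOn_fst fun p hp => hp.1)
      fun p hp => hFU.iterate n hp.1
  · simp [f, dyadicRamp_zero]
  · have h1 := ((Metric.continuous_infDist_pt X).tendsto _).comp (hfs x hx 1)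
    have h2 : Tendsto (fun N => (1 - κ) ^ N * Metric.infDist x X) atTop (𝓝 0) := by
      simpa using (tendsto_pow_atTop_nhds_zero_of_lt_one (by linarith : 0 ≤ 1 - κ)
        (by linarith)).mul_const (Metric.infDist x X)
    rw [hX.mem_iff_infDist_zero hne]
    refine le_antisymm (le_of_tendsto_of_tendsto' h1 h2 fun N => ?_) Metric.infDist_nonneg
    have := (hpart x hx 1 N).2 (by simp [dyadicRamp_one])
    simp only [Function.comp_apply]
    rw [this]
    exact hiter N x hx
  · have hVx : ∀ y ∈ X, V y = 0 := fun y hy =>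
      norm_le_zero_iff.1 ((hVn y).trans_eq (Metric.infDist_zero_of_mem hy))
    have hfix : F x = x := by simp [F, hVx x hx]
    simp [f, Function.iterate_fixed hfix, hVx x hx]
  · exact le_of_tendsto' (((Metric.continuous_infDist_pt X).tendsto _).comp (hfs x hx t))
      fun N => (hpart x hx t N).1

/-! ### The deformation retraction. -/

/-- The flow may leave the double offset but never the offset, so each stage can be projected back;
the projection fixes the double offset, hence the start, the end and `X`. -/
theorem deformationRetractsTo_doubleOffset {d : ℕ} {X : Set (EuclideanSpace ℝ (Fin d))}
    (hX : IsClosed X) (hne : X.Nonempty) {μ r s : ℝ} (hμ : 0 < μ) (hr : 0 < r) (hs : 0 < s)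
    (hsr : s ≤ r)
    (hg : ∀ x ∉ X, Metric.infDist x X < r → μ ≤ ‖generalizedGradient X x‖) (hsμ : s ≤ μ * r) :
    DeformationRetractsTo (doubleOffset r s X) X := by
  have hXD : X ⊆ doubleOffset r s X := fun x hx =>
    (mem_doubleOffset_iff hne).2 fun y hy => by
      rw [dist_comm]; exact (hsr.trans hy).trans (Metric.infDist_le_dist_of_mem hx)
  have hDU : doubleOffset r s X ⊆ {x | Metric.infDist x X < r} := fun x hx => by
    by_contra h
    have := (mem_doubleOffset_iff hne).1 hx x (not_lt.1 h)
    rw [dist_self] at this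
    exact absurd hs (not_lt.2 this)
  have hDc := isClosed_doubleOffset X r s
  choose proj hproj using nearestPoints_nonempty hDc (hne.mono hXD)
  have hprojc : ContinuousOn proj {x | Metric.infDist x X < r} := fun x hx => by
    refine ContinuousAt.continuousWithinAt fun N hN => ?_
    change ∀ᶠ y in 𝓝 x, proj y ∈ N
    -- Upper semicontinuity of a correspondence that is single-valued at `x` is continuity there.
    have := eventually_forall_nearestPoints hDc (x := x) (P := fun _ q => q ∈ N) fun q hq => by
      rw [eq_of_mem_nearestPoints_doubleOffset hX hne hμ hr hs hg hsμ hx hq (hproj x)]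
      exact continuous_snd.continuousAt.eventually hN
    filter_upwards [this] with y hy using hy _ (hproj y)
  have hprojD : ∀ x ∈ doubleOffset r s X, proj x = x := fun x hx =>
    dist_eq_zero.1 ((hproj x).2.trans (Metric.infDist_zero_of_mem hx))
  obtain ⟨H, hHc, hH0, hH1, hHX, hHd⟩ := exists_homotopy_to_zero_level hX hne hμ hg
  refine ⟨hXD, ⟨fun p => ⟨proj (H (p.1, p.2)), (hproj _).1⟩, ?_⟩, fun a => ?_, fun a => ?_,
    fun a ha t => ?_⟩
  · refine Continuous.subtype_mk ?_ _
    refine (hprojc.comp hHc fun p hp => (hHd p.1 p.2 hp.1).trans_lt hp.1).comp_continuous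
      (f := fun p : doubleOffset r s X × unitInterval => (p.1.1, p.2.1)) (by fun_prop)
      fun p => ⟨hDU p.1.2, trivial⟩
  · exact Subtype.ext (by simp [hH0, hprojD _ a.2])
  · have := hH1 a.1 (hDU a.2)
    simpa [hprojD _ (hXD this)] using this
  · exact Subtype.ext (by simp [hHX _ ha, hprojD _ a.2])

theorem le_norm_generalizedGradient_of_le_muReach {d : ℕ} {X : Set (EuclideanSpace ℝ (Fin d))}
    (hX : IsClosed X) (hne : X.Nonempty) {μ r : ℝ} (h : ENNReal.ofReal r ≤ muReach μ X)
    {x : EuclideanSpace ℝ (Fin d)} (hx : x ∉ X) (hxr : Metric.infDist x X < r) :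
    μ ≤ ‖generalizedGradient X x‖ := by
  by_contra! hlt
  obtain ⟨q, hq, hqx⟩ := nearestPoints_nonempty hX hne x
  have h1 : muReach μ X ≤ edist q x := iInf₂_le_of_le q hq (iInf₂_le x ⟨hx, hlt⟩)
  rw [edist_dist, hqx] at h1
  have hr : 0 < r := Metric.infDist_nonneg.trans_lt hxr
  exact absurd (h.trans h1) (not_le.2 ((ENNReal.ofReal_lt_ofReal_iff hr).2 hxr))

theorem mainTheorem7 {d : ℕ} (X : Set (EuclideanSpace ℝ (Fin d))) (hX : IsCompact X)
    (μ r s : ℝ) (hr : 0 < r) (hs : 0 < s) (hsr : s ≤ r)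
    (hrτ : ENNReal.ofReal r ≤ muReach μ X) (hsμ : s ≤ μ * r) :
    DeformationRetractsTo (doubleOffset r s X) X ∧
      ENNReal.ofReal s ≤ reach (doubleOffset r s X) := by
  have hμ : 0 < μ := by
    by_contra! h
    nlinarith
  -- The empty set is separate because `infDist` to it is 0 by convention.
  rcases X.eq_empty_or_nonempty with rfl | hne
  · have hD : doubleOffset r s (∅ : Set (EuclideanSpace ℝ (Fin d))) = ∅ := by
      refine Set.eq_empty_of_forall_notMem fun x hx => hx ?_
      exact Set.mem_biUnion (x := x) (by simp [offset]) (Metric.mem_ball_self hs)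
    rw [hD]
    exact ⟨⟨subset_rfl, ⟨Prod.fst, continuous_fst⟩, fun _ => rfl, fun a => a.2, fun _ _ _ => rfl⟩,
      le_iInf₂ fun q hq => absurd hq (Set.notMem_empty q)⟩
  · have hg : ∀ x ∉ X, Metric.infDist x X < r → μ ≤ ‖generalizedGradient X x‖ :=
      fun x => le_norm_generalizedGradient_of_le_muReach hX.isClosed hne hrτ
    exact ⟨deformationRetractsTo_doubleOffset hX.isClosed hne hμ hr hs hsr hg hsμ,
      ofReal_le_reach_doubleOffset hX.isClosed hne hμ hr hs hg hsμ⟩
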